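/- Let $H$ be a separable complex Hilbert space and let $M\subset B(H)$ be a finite von Neumann algebra, i.e. a von Neumann algebra (containing the identity of $H$) that admits a faithful normal trace: an ultra-weakly continuous linear functional $\tau$ on $M$ with $\tau(AB)=\tau(BA)$ for all $A,B\in M$, and with $\tau(A)\ge 0$ for every positive $A\in M$, where $\tau(A)=0$ only if $A=0$. A bounded real sequence $(u_n)$ is almost convergent to $c$ if $\lim_{n\to\infty}\sup_{k}\bigl|\frac1{n+1}\sum_{i=k}^{k+n}u_i-c\bigr|=0$, and strongly almost convergent to $c$ if $(|u_n-c|)$ is almost convergent to $0$. A regular gauge is a function $p\colon\mathbf N\to(0,\infty)$ for which there is $c_p>0$ such that $p(n+1)/p(n)$ is strongly almost convergent to $c_p$ and $c_p^n/p(n)$ is strongly almost convergent to $1$. An operator $T$ is compatible with $p$ if $\|T^n\|\le p(n)$ for all $n\ge1$ and $\|T^n\|/p(n)$ does not almost converge to $0$. For a bounded real sequence $\xi$ put $$q'(\xi)=\sup\Bigl\{\liminf_{k}\frac1m\sum_{i=1}^m\xi(n_i+k):\ m\ge 1,\ n_1,\dots,n_m\in\mathbf N\Bigr\},$$ and for a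 bounded real family $\xi(j_1,\dots,j_n)$ let $\widetilde Q_n(\xi)$ be the number obtained by applying $q'$ successively in the variables $j_n,j_{n-1},\dots,j_1$ (in this order). A set $\mathcal F$ of operators on $H$ is asymptotically controlled by $p$ if every $T\in\mathcal F$ is compatible with $p$ and for every nonzero $x\in H$ there is $\rho(x)>0$ such that $$\widetilde Q_n\left(\left\{\frac{\|T_1^{j_1}\cdots T_n^{j_n}x\|^2}{p(j_1)^2\cdots p(j_n)^2}\right\}_{j_1,\dots,j_n}\right)\ge\rho(x)$$ for all $n\ge1$ and all $T_1,\dots,T_n\in\mathcal F$. Theorem 3.2. Let $\mathcal S\subset M$ be a set of pairwise commuting operators that is asymptotically controlled by a regular gauge $p$. Then there is an invertible operator $A\in M$ (with $A^{-1}\in M$) such that, for every $T\in\mathcal S$, the spectral radius $r(T)$ is positive and $r(T)^{-1}ATA^{-1}$ is unitary. -/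

import Mathlib

open Filter Topology ComplexOrder

noncomputable section

namespace FiniteVN

/-! ### Almost convergence and gauges -/

/-- A bounded real sequence `u` is almost convergent to `c` when
`sup_k |(u k + ⋯ + u (k + n)) / (n + 1) - c| → 0` as `n → ∞`. -/
def AlmostConvergesTo (u : ℕ → ℝ) (c : ℝ) : Prop :=
  (∃ C : ℝ, ∀ n, |u n| ≤ C) ∧
    ∀ ε : ℝ, 0 < ε → ∃ N : ℕ, ∀ n ≥ N, ∀ k : ℕ,
      |(1 / ((n : ℝ) + 1)) * ∑ i ∈ Finset.Icc k (k + n), u i - c| ≤ ε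

/-- `u` is strongly almost convergent to `c` when `|u n - c|` is almost convergent to `0`. -/
def StronglyAlmostConvergesTo (u : ℕ → ℝ) (c : ℝ) : Prop :=
  AlmostConvergesTo (fun n => |u n - c|) 0

/-- `p` is a gauge with constant `c = c_p`: it takes values in `(0, ∞)` and `p (n + 1) / p n` is
strongly almost convergent to `c > 0` (such a `c` is unique). The value `p 0` is only required to
be positive: changing it has no effect on any of the notions below. -/
def IsGaugeWith (p : ℕ → ℝ) (c : ℝ) : Prop :=
  (∀ n, 0 < p n) ∧ 0 < c ∧ StronglyAlmostConvergesTo (fun n => p (n + 1) / p n) c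

/-- `p` is a regular gauge: a gauge such that `c_p ^ n / p n` is strongly almost convergent
to `1`. -/
def IsRegularGauge (p : ℕ → ℝ) : Prop :=
  ∃ c : ℝ, IsGaugeWith p c ∧ StronglyAlmostConvergesTo (fun n => c ^ n / p n) 1

/-! ### The functional `q'` and its iterates -/

/-- `q' ξ = sup { liminf_k (1/m) ∑_{i=1}^m ξ (n_i + k) : m ≥ 1, n_1, …, n_m ∈ ℕ }`
for a bounded real sequence `ξ`. -/
def qInf (ξ : ℕ → ℝ) : ℝ :=
  sSup {a : ℝ | ∃ m : ℕ, 1 ≤ m ∧ ∃ s : Fin m → ℕ,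
    a = liminf (fun k : ℕ => (1 / (m : ℝ)) * ∑ i, ξ (s i + k)) atTop}

/-- The iterate `Q̃_n = Q_1 ∘ ⋯ ∘ Q_n` on bounded real families `ξ (j_1, …, j_n)`:
`q'` is applied in the last variable `j_n` first, then in `j_{n-1}`, and finally in `j_1`. -/
def qIter : (n : ℕ) → ((Fin n → ℕ) → ℝ) → ℝ
  | 0, ξ => ξ Fin.elim0
  | n + 1, ξ => qIter n (fun j => qInf (fun l => ξ (Fin.snoc (α := fun _ => ℕ) j l)))

variable {H : Type*} [NormedAddCommGroup H] [InnerProductSpace ℂ H]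

/-! ### Operators and gauges -/

/-- `T` is dominated by `p`: `‖T ^ n‖ ≤ p n` for every positive integer `n`. -/
def IsDominated (T : H →L[ℂ] H) (p : ℕ → ℝ) : Prop :=
  ∀ n : ℕ, 1 ≤ n → ‖T ^ n‖ ≤ p n

/-- `T` is compatible with `p`: it is dominated by `p` and `‖T ^ n‖ / p n` does not almost
converge to `0`. -/
def IsCompatible (T : H →L[ℂ] H) (p : ℕ → ℝ) : Prop :=
  IsDominated T p ∧ ¬ AlmostConvergesTo (fun n => ‖T ^ n‖ / p n) 0

/-- A set `F` of operators is asymptotically controlled by `p`: its elements are compatible with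
`p`, and for every nonzero `x` there is `ρ > 0` such that, for all `n ≥ 1` and
`T_1, …, T_n ∈ F`, the functional `Q̃_n` of the family
`⟨(T_1^{j_1} ⋯ T_n^{j_n})^* (T_1^{j_1} ⋯ T_n^{j_n}) x, x⟩ / (p(j_1)^2 ⋯ p(j_n)^2)
 = ‖T_1^{j_1} ⋯ T_n^{j_n} x‖^2 / (p(j_1)^2 ⋯ p(j_n)^2)` is at least `ρ`. -/
def IsAsymptoticallyControlled (F : Set (H →L[ℂ] H)) (p : ℕ → ℝ) : Prop :=
  (∀ T ∈ F, IsCompatible T p) ∧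
    ∀ x : H, x ≠ 0 → ∃ ρ : ℝ, 0 < ρ ∧
      ∀ n : ℕ, 1 ≤ n → ∀ T : Fin n → (H →L[ℂ] H), (∀ i, T i ∈ F) →
        ρ ≤ qIter n (fun j =>
          ‖(List.ofFn (fun i => T i ^ j i)).prod x‖ ^ 2 / ∏ i, p (j i) ^ 2)

/-! ### Finite von Neumann algebras -/

/-- The ultra-weak topology on `B(H)`: the coarsest topology making the functionals
`a ↦ ∑ n, ⟪y n, a (x n)⟫` continuous, for all square-summable sequences `x`, `y` in `H`
(these are the functionals given by the trace class operators). -/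
abbrev ultraweakTopology (H : Type*) [NormedAddCommGroup H] [InnerProductSpace ℂ H] :
    TopologicalSpace (H →L[ℂ] H) :=
  TopologicalSpace.induced
    (fun (a : H →L[ℂ] H) (xy : lp (fun _ : ℕ => H) 2 × lp (fun _ : ℕ => H) 2) =>
      ∑' n, inner ℂ (xy.2 n) (a (xy.1 n)))
    Pi.topologicalSpace

variable [CompleteSpace H]

/-- `τ` is a faithful normal trace on `M`: an ultra-weakly continuous linear functional on `M`
with `τ (A B) = τ (B A)`, `τ A ≥ 0` for `A ≥ 0` in `M`, and `τ A = 0` only if `A = 0` for such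
`A`. -/
structure IsFaithfulNormalTrace (M : VonNeumannAlgebra H)
    (τ : M.toStarSubalgebra →ₗ[ℂ] ℂ) : Prop where
  /-- `τ` is continuous for the topology on `M` induced by the ultra-weak topology. -/
  normal : Continuous[TopologicalSpace.induced
      (Subtype.val : M.toStarSubalgebra → (H →L[ℂ] H)) (ultraweakTopology H), inferInstance] τ
  /-- `τ` is a trace. -/
  tracial : ∀ A B : M.toStarSubalgebra, τ (A * B) = τ (B * A)
  /-- `τ` is positive. -/
  nonneg : ∀ A : M.toStarSubalgebra, (A : H →L[ℂ] H).IsPositive → 0 ≤ τ A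
  /-- `τ` is faithful. -/
  faithful : ∀ A : M.toStarSubalgebra, (A : H →L[ℂ] H).IsPositive → τ A = 0 → A = 0

/-- A von Neumann algebra is finite when it admits a faithful normal trace. -/
def IsFinite (M : VonNeumannAlgebra H) : Prop :=
  ∃ τ : M.toStarSubalgebra →ₗ[ℂ] ℂ, IsFaithfulNormalTrace M τ

end FiniteVN

end

/-!
Every `T ∈ S` turns out to be a multiple of a unitary: `T⋆T = c² = TT⋆`, where `c` is the constant
of the gauge `p`. Since the gauge is regular, `cⁿ/p(n)` is `1` on average, so `p` leaves no room for
a constant between `‖Tⁿ‖` and `cⁿ`, and the trace turns this into unitarity of `c⁻¹T`. Such a `T` is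
normal, hence `r(T) = ‖T‖ = c`, and the identity is an admissible conjugating operator.

To see that `c⁻¹T` is unitary, let `B` and `D` be weak operator limits, along a free ultrafilter, of
the Cesàro averages of `T⋆ⁿTⁿ/p(n)²` and of `TⁿT⋆ⁿ/p(n)²`. As `‖Tⁿ‖ ≤ p(n)`, both lie between `0`
and `1`; as `p(n+1)/p(n)` is `c` on average, `T⋆BT = c²B` and `TDT⋆ = c²D`
(`exists_invariant_of_isDominated`). Asymptotic control, used for a single operator, gives
`⟨Bx, x⟩ > 0` for `x ≠ 0`, because `q'` is a lower bound for Cesàro limits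
(`eventually_le_cesaro_of_le_qInf`, `inner_ne_zero_of_le_qInf`).

Now let `τ` be the trace; by normality it is continuous along bounded weakly convergent sequences.
Invariance of `B` gives `τ(B TⁿT⋆ⁿ)/p(n)² = τ(T⋆ⁿBTⁿ)/p(n)² = (cⁿ/p(n))² τ(B)`, and averaging yields
`τ(BD) = τ(B)`, that is `τ(B(1 - D)) = 0`. Since `1 - D ≥ 0`, `τ` is faithful and `B` is injective,
`D = 1`. Finally `τ(B) = τ(D) = τ(1)` by the trace property, so `τ(1 - B) = 0` and `B = 1`. The
invariance relations now read `T⋆T = c² = TT⋆` (`IsFaithfulNormalTrace.star_mul_self_eq`).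
-/

open Filter Topology ComplexOrder

noncomputable section

namespace FiniteVN

/-! ### Cesàro averages -/

section Cesaro

variable {𝕜 E : Type*} [RCLike 𝕜]

section Algebra

variable [AddCommGroup E] [Module 𝕜 E]

variable (𝕜) in
/-- The average `(u 1 + ⋯ + u (n + 1)) / (n + 1)`. The index `0` is left out because the domination
`‖T ^ n‖ ≤ p n` is only assumed for `n ≥ 1`. -/
def cesaro (u : ℕ → E) (n : ℕ) : E :=
  ((n : 𝕜) + 1)⁻¹ • ∑ i ∈ Finset.range (n + 1), u (i + 1)

theorem cesaro_sub (u v : ℕ → E) (n : ℕ) :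
    cesaro 𝕜 (fun i => u i - v i) n = cesaro 𝕜 u n - cesaro 𝕜 v n := by
  simp [cesaro, Finset.sum_sub_distrib, smul_sub]

theorem map_cesaro {F : Type*} [AddCommGroup F] [Module 𝕜 F] (f : E →ₗ[𝕜] F)
    (u : ℕ → E) (n : ℕ) : f (cesaro 𝕜 u n) = cesaro 𝕜 (fun i => f (u i)) n := by
  simp [cesaro]

theorem cesaro_const (a : E) (n : ℕ) : cesaro 𝕜 (fun _ => a) n = a := by
  have h : ((n : 𝕜) + 1) ≠ 0 := by exact_mod_cast n.succ_ne_zero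
  simp only [cesaro, Finset.sum_const, Finset.card_range]
  rw [← Nat.cast_smul_eq_nsmul 𝕜, smul_smul]
  push_cast
  rw [inv_mul_cancel₀ h, one_smul]

end Algebra

section Norm

variable [NormedAddCommGroup E] [NormedSpace 𝕜 E]

theorem norm_inv_natCast_add_one (n : ℕ) : ‖((n : 𝕜) + 1)⁻¹‖ = ((n : ℝ) + 1)⁻¹ := by
  rw [norm_inv, ← Nat.cast_add_one, RCLike.norm_natCast]
  push_cast
  rfl

theorem norm_cesaro_le (u : ℕ → E) (n : ℕ) :
    ‖cesaro 𝕜 u n‖ ≤ cesaro ℝ (fun i => ‖u i‖) n := by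
  rw [cesaro, cesaro, norm_smul, norm_inv_natCast_add_one, smul_eq_mul]
  gcongr
  exact norm_sum_le _ _

theorem cesaro_mono {u v : ℕ → ℝ} (h : ∀ i, 1 ≤ i → u i ≤ v i) (n : ℕ) :
    cesaro ℝ u n ≤ cesaro ℝ v n := by
  rw [cesaro, cesaro, smul_eq_mul, smul_eq_mul]
  gcongr with i
  exact h _ (by omega)

theorem norm_cesaro_le_of_le {u : ℕ → E} {C : ℝ} (h : ∀ i, 1 ≤ i → ‖u i‖ ≤ C) (n : ℕ) :
    ‖cesaro 𝕜 u n‖ ≤ C :=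
  (norm_cesaro_le u n).trans ((cesaro_mono h n).trans_eq (cesaro_const C n))

/-- Cesàro averages go to zero as soon as the averages of a majorant of the norms do. -/
theorem tendsto_cesaro_zero_of_le {u : ℕ → E} {v : ℕ → ℝ} (h : ∀ i, 1 ≤ i → ‖u i‖ ≤ v i)
    (hv : Tendsto (cesaro ℝ v) atTop (𝓝 0)) : Tendsto (cesaro 𝕜 u) atTop (𝓝 0) :=
  squeeze_zero_norm (fun n => (norm_cesaro_le u n).trans (cesaro_mono h n)) hv

theorem tendsto_inv_natCast_add_one : Tendsto (fun n : ℕ => ((n : ℝ) + 1)⁻¹) atTop (𝓝 0) := by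
  simpa [one_div] using tendsto_one_div_add_atTop_nhds_zero_nat (𝕜 := ℝ)

theorem tendsto_cesaro_succ_sub {u : ℕ → E} {C : ℝ} (h : ∀ i, 1 ≤ i → ‖u i‖ ≤ C) :
    Tendsto (fun n => cesaro 𝕜 (fun i => u (i + 1)) n - cesaro 𝕜 u n) atTop (𝓝 0) := by
  have hlim : Tendsto (fun n : ℕ => ((n : ℝ) + 1)⁻¹ * (2 * C)) atTop (𝓝 0) := by
    simpa using tendsto_inv_natCast_add_one.mul_const (2 * C)
  refine squeeze_zero_norm (fun n => ?_) hlim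
  rw [← cesaro_sub, cesaro, norm_smul, norm_inv_natCast_add_one,
    Finset.sum_range_sub (fun i => u (i + 1))]
  gcongr
  refine (norm_sub_le _ _).trans ?_
  linarith [h (n + 1 + 1) (by omega), h (0 + 1) (by omega)]

theorem tendsto_cesaro_add_sub {u : ℕ → E} {C : ℝ} (h : ∀ i, 1 ≤ i → ‖u i‖ ≤ C) (s : ℕ) :
    Tendsto (fun n => cesaro 𝕜 (fun i => u (i + s)) n - cesaro 𝕜 u n) atTop (𝓝 0) := by
  induction s with
  | zero => simp
  | succ s ih =>
    have := (tendsto_cesaro_succ_sub (𝕜 := 𝕜) (u := fun i => u (i + s))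
      (fun i hi => h (i + s) (by omega))).add ih
    simpa [add_assoc, add_comm 1 s] using this

/-- The averages of a sequence that vanishes from some index on tend to zero. -/
theorem tendsto_cesaro_zero_of_eventually_eq_zero {u : ℕ → E} (h : ∀ᶠ i in atTop, u i = 0) :
    Tendsto (cesaro 𝕜 u) atTop (𝓝 0) := by
  obtain ⟨K, hK⟩ := eventually_atTop.1 h
  have hlim : Tendsto (fun n : ℕ => ((n : ℝ) + 1)⁻¹ * ∑ i ∈ Finset.range K, ‖u (i + 1)‖)
      atTop (𝓝 0) := by
    simpa using tendsto_inv_natCast_add_one.mul_const (∑ i ∈ Finset.range K, ‖u (i + 1)‖)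
  refine squeeze_zero_norm' ?_ hlim
  filter_upwards [eventually_ge_atTop K] with n hn
  rw [cesaro, norm_smul, norm_inv_natCast_add_one]
  gcongr
  rw [← Finset.sum_subset (Finset.range_mono (show K ≤ n + 1 by omega))]
  · exact norm_sum_le _ _
  · intro i _ hi
    exact hK _ (by simp at hi; omega)

end Norm

theorem AlmostConvergesTo.tendsto_cesaro {u : ℕ → ℝ} {c : ℝ} (h : AlmostConvergesTo u c) :
    Tendsto (cesaro ℝ u) atTop (𝓝 c) := by
  rw [Metric.tendsto_atTop]
  intro ε hε
  obtain ⟨N, hN⟩ := h.2 (ε / 2) (by positivity)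
  refine ⟨N, fun n hn => ?_⟩
  have := hN n hn 1
  rw [Real.dist_eq, cesaro, smul_eq_mul]
  rw [one_div, show Finset.Icc 1 (1 + n) = Finset.Ico 1 (n + 2) by ext; simp; omega,
    Finset.sum_Ico_eq_sum_range] at this
  simp only [add_comm 1] at this
  exact this.trans_lt (by linarith)

theorem StronglyAlmostConvergesTo.exists_bound {u : ℕ → ℝ} {c : ℝ}
    (h : StronglyAlmostConvergesTo u c) : ∃ C, 0 ≤ C ∧ ∀ n, |u n| ≤ C := by
  obtain ⟨C, hC⟩ := h.1
  refine ⟨C + |c|, ?_, fun n => ?_⟩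
  · have := (abs_nonneg _).trans (hC 0)
    positivity
  · have := hC n
    rw [abs_abs] at this
    linarith [abs_sub_abs_le_abs_sub (u n) c]

/-- Strong almost convergence passes to squares, at the level of Cesàro averages. -/
theorem StronglyAlmostConvergesTo.tendsto_cesaro_sq {u : ℕ → ℝ} {c : ℝ}
    (h : StronglyAlmostConvergesTo u c) :
    Tendsto (cesaro ℝ (fun n => |u n ^ 2 - c ^ 2|)) atTop (𝓝 0) := by
  obtain ⟨C, hC0, hC⟩ := h.exists_bound
  refine tendsto_cesaro_zero_of_le (v := fun n => (C + |c|) * |u n - c|) (fun i _ => ?_) ?_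
  · rw [Real.norm_eq_abs, abs_abs, sq_sub_sq, abs_mul]
    gcongr
    exact (abs_add_le _ _).trans (by linarith [hC i])
  · have := (AlmostConvergesTo.tendsto_cesaro h).const_mul (C + |c|)
    rw [mul_zero] at this
    refine this.congr fun n => ?_
    exact map_cesaro (LinearMap.mulLeft ℝ (C + |c|)) _ n

/-- The functional `q'` is dominated by Cesàro means: a bounded nonnegative sequence on which `q'`
exceeds `ρ > 0` has averages that are eventually bounded away from zero. -/
theorem eventually_le_cesaro_of_le_qInf {ξ : ℕ → ℝ} {C ρ : ℝ} (h0 : ∀ i, 0 ≤ ξ i)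
    (hC : ∀ i, 1 ≤ i → ξ i ≤ C) (hρ : 0 < ρ) (h : ρ ≤ qInf ξ) :
    ∀ᶠ n in atTop, ρ / 4 ≤ cesaro ℝ ξ n := by
  obtain ⟨a, ⟨m, hm, s, rfl⟩, ha⟩ := exists_lt_of_lt_csSup
    (by exact ⟨_, 1, le_rfl, fun _ => 0, rfl⟩) (show ρ / 2 < qInf ξ by linarith)
  have hm0 : (0 : ℝ) < m := by exact_mod_cast hm
  set η : ℕ → ℝ := fun k => (1 / (m : ℝ)) * ∑ i, ξ (s i + k) with hη
  have hη0 : ∀ k, 0 ≤ η k := fun k => mul_nonneg (by positivity) (Finset.sum_nonneg fun i _ => h0 _)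
  have hev : ∀ᶠ k in atTop, ρ / 2 < η k :=
    eventually_lt_of_lt_liminf ha (isBoundedUnder_of ⟨0, hη0⟩)
  -- the averages of `η` differ from those of `ξ` by a null sequence
  have hdiff : Tendsto (fun n => cesaro ℝ η n - cesaro ℝ ξ n) atTop (𝓝 0) := by
    have h1 : Tendsto (fun n => ∑ i : Fin m,
        (cesaro ℝ (fun k => ξ (k + s i)) n - cesaro ℝ ξ n)) atTop (𝓝 (∑ i : Fin m, (0 : ℝ))) :=
      tendsto_finsetSum _ fun i _ => tendsto_cesaro_add_sub (𝕜 := ℝ) (C := C)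
        (fun i hi => by rw [Real.norm_eq_abs, abs_of_nonneg (h0 i)]; exact hC i hi) (s i)
    have h2 := h1.const_mul (1 / (m : ℝ))
    simp only [Finset.sum_const_zero, mul_zero] at h2
    refine h2.congr fun n => ?_
    rw [Finset.sum_sub_distrib, Finset.sum_const, Finset.card_univ, Fintype.card_fin, nsmul_eq_mul,
      mul_sub, one_div, inv_mul_cancel_left₀ hm0.ne']
    congr 1
    simp only [cesaro, hη, smul_eq_mul, ← Finset.mul_sum]
    rw [Finset.sum_comm, one_div]
    simp only [add_comm, Finset.mul_sum]
    exact Finset.sum_congr rfl fun _ _ => Finset.sum_congr rfl fun _ _ => by ring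
  -- `η` is at least `ρ / 2` up to a sequence of finite support
  have hsmall : Tendsto (cesaro ℝ (fun k => max (ρ / 2 - η k) 0)) atTop (𝓝 0) :=
    tendsto_cesaro_zero_of_eventually_eq_zero (hev.mono fun k hk => by simp [hk.le])
  have hlow : ∀ n, ρ / 2 - cesaro ℝ η n ≤ cesaro ℝ (fun k => max (ρ / 2 - η k) 0) n := fun n => by
    rw [← cesaro_const (𝕜 := ℝ) (ρ / 2) n, ← cesaro_sub]
    exact cesaro_mono (fun i _ => by simp [cesaro_const]) n
  filter_upwards [hdiff.eventually_lt_const (show (0 : ℝ) < ρ / 8 by positivity),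
    hsmall.eventually_lt_const (show (0 : ℝ) < ρ / 8 by positivity)] with n h1 h2
  linarith [hlow n]

end Cesaro

/-! ### Weak limits of bounded sequences of operators -/

section WeakLimit

variable {H : Type*} [NormedAddCommGroup H] [InnerProductSpace ℂ H]

/-- `X` converges to `D` along the filter `l` for the weak operator topology. -/
def WeaklyTendsto (X : ℕ → H →L[ℂ] H) (l : Filter ℕ) (D : H →L[ℂ] H) : Prop :=
  ∀ x y, Tendsto (fun n => inner ℂ x (X n y)) l (𝓝 (inner ℂ x (D y)))

theorem norm_inner_apply_le {X : H →L[ℂ] H} {C : ℝ} (hX : ‖X‖ ≤ C) (x y : H) :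
    ‖inner ℂ x (X y)‖ ≤ C * ‖x‖ * ‖y‖ :=
  calc ‖inner ℂ x (X y)‖ ≤ ‖x‖ * ‖X y‖ := norm_inner_le_norm _ _
    _ ≤ ‖x‖ * (C * ‖y‖) := by gcongr; exact X.le_of_opNorm_le hX y
    _ = C * ‖x‖ * ‖y‖ := by ring

/-- Bounded sets of operators are relatively compact for the weak operator topology. -/
theorem exists_weaklyTendsto [CompleteSpace H] (X : ℕ → H →L[ℂ] H) {C : ℝ} (hX : ∀ n, ‖X n‖ ≤ C)
    (U : Ultrafilter ℕ) : ∃ D, WeaklyTendsto X U D := by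
  have key : ∀ x y : H, ∃ z ∈ Metric.closedBall (0 : ℂ) (C * ‖x‖ * ‖y‖),
      Tendsto (fun n => inner ℂ x (X n y)) U (𝓝 z) := fun x y => by
    obtain ⟨z, hz, hz'⟩ := (isCompact_closedBall (0 : ℂ) (C * ‖x‖ * ‖y‖)).ultrafilter_le_nhds
      (U.map fun n => inner ℂ x (X n y)) (le_principal_iff.2 (Ultrafilter.mem_coe.2
        (Ultrafilter.mem_map.2 (univ_mem' fun n => by
          simpa using norm_inner_apply_le (hX n) x y))))
    exact ⟨z, hz, hz'⟩
  choose b hb hlim using key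
  let B : H →L⋆[ℂ] H →L[ℂ] ℂ := LinearMap.mkContinuous₂
    (LinearMap.mk₂'ₛₗ (starRingEnd ℂ) (RingHom.id ℂ) b
      (fun x x' y => tendsto_nhds_unique (hlim _ _)
        (((hlim x y).add (hlim x' y)).congr fun n => by rw [inner_add_left]))
      (fun a x y => tendsto_nhds_unique (hlim _ _)
        (((hlim x y).const_mul (starRingEnd ℂ a)).congr fun n => by rw [inner_smul_left]))
      (fun x y y' => tendsto_nhds_unique (hlim _ _)
        (((hlim x y).add (hlim x y')).congr fun n => by rw [map_add, inner_add_right]))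
      (fun a x y => tendsto_nhds_unique (hlim _ _)
        (((hlim x y).const_mul a).congr fun n => by rw [map_smul, inner_smul_right])))
    C (fun x y => by simpa using hb x y)
  refine ⟨ContinuousLinearMap.adjoint (InnerProductSpace.continuousLinearMapOfBilin B),
    fun x y => ?_⟩
  rw [ContinuousLinearMap.adjoint_inner_right, InnerProductSpace.continuousLinearMapOfBilin_apply]
  exact hlim x y

theorem isPositive_of_inner_nonneg {T : H →L[ℂ] H} (h : ∀ x, 0 ≤ inner ℂ x (T x)) :
    T.IsPositive := by
  rw [ContinuousLinearMap.isPositive_iff_complex]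
  intro x
  have h1 := h x
  rw [← inner_conj_symm, Complex.le_def] at h1
  simp only [Complex.zero_re, Complex.conj_re, Complex.zero_im, Complex.conj_im] at h1
  refine ⟨Complex.ext (by simp) ?_, by simpa using h1.1⟩
  simp only [Complex.ofReal_im]
  linarith [h1.2]

namespace WeaklyTendsto

variable {X Y : ℕ → H →L[ℂ] H} {l : Filter ℕ} {D : H →L[ℂ] H}

theorem isPositive [l.NeBot] (h : WeaklyTendsto X l D) (hX : ∀ n, (X n).IsPositive) :
    D.IsPositive :=
  isPositive_of_inner_nonneg fun x =>
    ge_of_tendsto (h x x) (Eventually.of_forall fun n => (hX n).inner_nonneg_right x)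

theorem one_sub (h : WeaklyTendsto X l D) :
    WeaklyTendsto (fun n => 1 - X n) l (1 - D) := fun x y => by
  simpa [inner_sub_right] using (h x y).const_sub (inner ℂ x y)

theorem const_mul [CompleteSpace H] (h : WeaklyTendsto X l D) (b : H →L[ℂ] H) :
    WeaklyTendsto (fun n => b * X n) l (b * D) := fun x y => by
  simpa [ContinuousLinearMap.adjoint_inner_left] using h (ContinuousLinearMap.adjoint b x) y

theorem mul_const (h : WeaklyTendsto X l D) (b : H →L[ℂ] H) :
    WeaklyTendsto (fun n => X n * b) l (D * b) := fun x y => h x (b y)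

theorem const_smul (h : WeaklyTendsto X l D) (a : ℂ) :
    WeaklyTendsto (fun n => a • X n) l (a • D) := fun x y => by
  simpa [inner_smul_right] using (h x y).const_mul a

theorem unique [l.NeBot] (h : WeaklyTendsto X l D) {D' : H →L[ℂ] H} (h' : WeaklyTendsto X l D') :
    D = D' :=
  ContinuousLinearMap.ext fun y => ext_inner_left ℂ fun x => tendsto_nhds_unique (h x y) (h' x y)

/-- Sequences whose difference tends to zero in norm have the same weak limits. -/
theorem congr_norm (h : WeaklyTendsto X l D) (hXY : Tendsto (fun n => Y n - X n) l (𝓝 0)) :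
    WeaklyTendsto Y l D := fun x y => by
  have h1 : Tendsto (fun n => inner ℂ x ((Y n - X n) y)) l (𝓝 (inner ℂ x ((0 : H →L[ℂ] H) y))) :=
    tendsto_const_nhds.inner (((ContinuousLinearMap.apply ℂ H y).continuous.tendsto 0).comp hXY)
  simpa [inner_sub_right] using h1.add (h x y)

/-- A von Neumann algebra is closed for the weak operator topology. -/
theorem mem_vonNeumannAlgebra [CompleteSpace H] [l.NeBot] {M : VonNeumannAlgebra H}
    (h : WeaklyTendsto X l D) (hX : ∀ n, X n ∈ M) : D ∈ M := by
  rw [← M.commutant_commutant, VonNeumannAlgebra.mem_commutant_iff]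
  intro g hg
  rw [VonNeumannAlgebra.mem_commutant_iff] at hg
  refine (h.const_mul g).unique ?_
  simpa only [hg _ (hX _)] using h.mul_const g

end WeaklyTendsto

variable [CompleteSpace H]

/-- On bounded sequences, a normal functional is continuous for the weak operator topology. -/
theorem IsFaithfulNormalTrace.tendsto {M : VonNeumannAlgebra H} {τ : M.toStarSubalgebra →ₗ[ℂ] ℂ}
    (hτ : IsFaithfulNormalTrace M τ) {X : ℕ → M.toStarSubalgebra} {D : M.toStarSubalgebra}
    {l : Filter ℕ} {C : ℝ} (hC : ∀ n, ‖(X n : H →L[ℂ] H)‖ ≤ C)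
    (h : WeaklyTendsto (fun n => (X n : H →L[ℂ] H)) l D) :
    Tendsto (fun n => τ (X n)) l (𝓝 (τ D)) := by
  let _ : TopologicalSpace M.toStarSubalgebra := TopologicalSpace.induced
    (Subtype.val : M.toStarSubalgebra → (H →L[ℂ] H)) (ultraweakTopology H)
  have hcont : Continuous τ := hτ.normal
  refine (hcont.tendsto D).comp ?_
  rw [@nhds_induced _ _ (ultraweakTopology H) Subtype.val D, tendsto_comap_iff, nhds_induced, tendsto_comap_iff, tendsto_pi_nhds]
  rintro ⟨x, y⟩
  have hx := (lp.memℓp x).summable (by norm_num)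
  have hy := (lp.memℓp y).summable (by norm_num)
  simp only [ENNReal.toReal_ofNat, Real.rpow_ofNat] at hx hy
  have hC0 : ∀ n : ℕ, 0 ≤ C := fun n => (norm_nonneg _).trans (hC n)
  refine tendsto_tsum_of_dominated_convergence (bound := fun k => C * (‖x k‖ ^ 2 + ‖y k‖ ^ 2))
    ((hx.add hy).mul_left C) (fun k => h _ _) (Eventually.of_forall fun n k => ?_)
  refine (norm_inner_apply_le (hC n) _ _).trans ?_
  rw [mul_assoc]
  refine mul_le_mul_of_nonneg_left ?_ (hC0 n)
  nlinarith [sq_nonneg (‖x k‖ - ‖y k‖), sq_nonneg (‖x k‖ ), sq_nonneg (‖y k‖)]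

end WeakLimit

/-! ### Consequences of compatibility and control -/

section Control

variable {H : Type*} [NormedAddCommGroup H] [InnerProductSpace ℂ H]

theorem IsCompatible.nontrivial {T : H →L[ℂ] H} {p : ℕ → ℝ} (h : IsCompatible T p) :
    Nontrivial H := by
  by_contra hH
  rw [not_nontrivial_iff_subsingleton] at hH
  have h0 : ∀ n, ‖T ^ n‖ = 0 := fun n => by
    rw [Subsingleton.elim (T ^ n) 0, norm_zero]
  refine h.2 ⟨⟨0, fun n => by simp [h0]⟩, fun ε hε => ⟨0, fun n _ k => ?_⟩⟩
  simpa [h0] using hε.le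

/-- The case `n = 1` of asymptotic control. -/
theorem IsAsymptoticallyControlled.exists_le_qInf {F : Set (H →L[ℂ] H)} {p : ℕ → ℝ}
    (h : IsAsymptoticallyControlled F p) {T : H →L[ℂ] H} (hT : T ∈ F) {x : H} (hx : x ≠ 0) :
    ∃ ρ : ℝ, 0 < ρ ∧ ρ ≤ qInf fun i => ‖(T ^ i) x‖ ^ 2 / p i ^ 2 := by
  obtain ⟨ρ, hρ, hle⟩ := h.2 x hx
  refine ⟨ρ, hρ, ?_⟩
  simpa [qIter, Fin.snoc] using hle 1 le_rfl (fun _ => T) (fun _ => hT)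

theorem norm_sq_div_le {T : H →L[ℂ] H} {p : ℕ → ℝ} (hp : ∀ n, 0 < p n) (h : IsDominated T p) (x : H) (i : ℕ) (hi : 1 ≤ i) :
    ‖(T ^ i) x‖ ^ 2 / p i ^ 2 ≤ ‖x‖ ^ 2 := by
  rw [div_le_iff₀ (pow_pos (hp i) 2), ← mul_pow, mul_comm]
  gcongr
  exact (T ^ i).le_of_opNorm_le (h i hi) x

end Control

/-! ### Averaged orbits and the invariant operator -/

section PowerAverage

variable {A : Type*} [Ring A] [StarRing A] [Algebra ℂ A]

/-- The Cesàro averages of the sequence `T⋆ⁿ Tⁿ / p(n)²`. -/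
def powerAverage (p : ℕ → ℝ) (T : A) (n : ℕ) : A :=
  cesaro ℂ (fun i => ((p i : ℂ) ^ 2)⁻¹ • (star (T ^ i) * T ^ i)) n

theorem star_pow_mul_mul_pow {T B : A} {a : ℂ} (h : star T * B * T = a • B) (n : ℕ) :
    star (T ^ n) * B * T ^ n = a ^ n • B := by
  induction n with
  | zero => simp
  | succ n ih =>
    calc star (T ^ (n + 1)) * B * T ^ (n + 1)
        = star T * (star (T ^ n) * B * T ^ n) * T := by
          rw [pow_succ, star_mul]; simp only [mul_assoc]
      _ = a ^ (n + 1) • B := by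
          rw [ih, mul_smul_comm, smul_mul_assoc, h, smul_smul, pow_succ]

end PowerAverage

variable {H : Type*} [NormedAddCommGroup H] [InnerProductSpace ℂ H] [CompleteSpace H]

section Asymptotic

variable {T : H →L[ℂ] H} {p : ℕ → ℝ}

theorem IsDominated.star (h : IsDominated T p) : IsDominated (star T) p := fun n hn => by
  rw [← star_pow, norm_star]
  exact h n hn

theorem norm_powerAverage_term_le (hp : ∀ n, 0 < p n) (h : IsDominated T p) (i : ℕ) (hi : 1 ≤ i) :
    ‖((p i : ℂ) ^ 2)⁻¹ • (Star.star (T ^ i) * T ^ i)‖ ≤ 1 := by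
  rw [norm_smul, CStarRing.norm_star_mul_self, norm_inv, norm_pow, Complex.norm_real,
    Real.norm_of_nonneg (hp i).le, inv_mul_le_one₀ (pow_pos (hp i) 2), sq]
  exact mul_le_mul (h i hi) (h i hi) (norm_nonneg _) (hp i).le

theorem norm_powerAverage_le (hp : ∀ n, 0 < p n) (h : IsDominated T p) (n : ℕ) :
    ‖powerAverage p T n‖ ≤ 1 :=
  norm_cesaro_le_of_le (norm_powerAverage_term_le hp h) n

theorem inner_powerAverage (x : H) (n : ℕ) :
    inner ℂ x (powerAverage p T n x) = (cesaro ℝ (fun i => ‖(T ^ i) x‖ ^ 2 / p i ^ 2) n : ℝ) := by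
  have hterm : ∀ i, inner ℂ x ((((p i : ℂ) ^ 2)⁻¹ • (Star.star (T ^ i) * T ^ i)) x)
      = ((‖(T ^ i) x‖ ^ 2 / p i ^ 2 : ℝ) : ℂ) := fun i => by
    have h : inner ℂ x ((Star.star (T ^ i) * T ^ i) x) = (‖(T ^ i) x‖ : ℂ) ^ 2 := by
      rw [mul_apply_eq_comp, ContinuousLinearMap.star_eq_adjoint,
        ContinuousLinearMap.adjoint_inner_right]
      exact inner_self_eq_norm_sq_to_K _
    rw [smul_apply, inner_smul_right, h]
    push_cast
    rw [div_eq_inv_mul]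
  have h := map_cesaro ((innerSL ℂ x).comp (ContinuousLinearMap.apply ℂ H x)).toLinearMap
    (fun i => ((p i : ℂ) ^ 2)⁻¹ • (Star.star (T ^ i) * T ^ i)) n
  refine h.trans ((congrArg (fun u => cesaro ℂ u n) (funext hterm)).trans ?_)
  simp only [cesaro, smul_eq_mul, Complex.ofReal_mul, Complex.ofReal_sum]
  push_cast
  rfl

theorem isPositive_powerAverage (n : ℕ) : (powerAverage p T n).IsPositive := by
  refine isPositive_of_inner_nonneg fun x => ?_
  rw [inner_powerAverage, Complex.zero_le_real, cesaro]
  exact mul_nonneg (by positivity) (Finset.sum_nonneg fun i _ => by positivity)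

theorem isPositive_one_sub_powerAverage (hp : ∀ n, 0 < p n) (h : IsDominated T p) (n : ℕ) :
    (1 - powerAverage p T n).IsPositive := by
  refine isPositive_of_inner_nonneg fun x => ?_
  have hx : inner ℂ x ((1 : H →L[ℂ] H) x) = ((‖x‖ ^ 2 : ℝ) : ℂ) := by
    push_cast
    exact inner_self_eq_norm_sq_to_K x
  rw [sub_apply, inner_sub_right, inner_powerAverage, hx, ← Complex.ofReal_sub,
    Complex.zero_le_real, sub_nonneg]
  exact (cesaro_mono (norm_sq_div_le hp h x) n).trans_eq (cesaro_const _ n)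

/-- The averages are asymptotically invariant: conjugating `T⋆ⁿ Tⁿ / p(n)²` by `T` gives
`(p(n + 1) / p(n))²` times the next term, and this factor is `c²` up to a sequence whose averages
tend to zero. -/
theorem tendsto_conj_powerAverage_sub {c : ℝ} (hp : IsGaugeWith p c) (h : IsDominated T p) :
    Tendsto (fun n => Star.star T * powerAverage p T n * T - ((c : ℂ) ^ 2) • powerAverage p T n)
      atTop (𝓝 0) := by
  obtain ⟨hp0, hc, hpc⟩ := hp
  obtain ⟨u, hu⟩ : ∃ u : ℕ → H →L[ℂ] H,
      ∀ i, u i = ((p i : ℂ) ^ 2)⁻¹ • (Star.star (T ^ i) * T ^ i) := ⟨_, fun _ => rfl⟩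
  have hu1 : ∀ i, 1 ≤ i → ‖u i‖ ≤ 1 := fun i hi => by
    rw [hu]; exact norm_powerAverage_term_le hp0 h i hi
  have hav : powerAverage p T = cesaro ℂ u := by rw [funext hu]; rfl
  have hstep : ∀ i, Star.star T * u i * T - ((c : ℂ) ^ 2) • u (i + 1)
      = (((p (i + 1) / p i) ^ 2 - c ^ 2 : ℝ) : ℂ) • u (i + 1) := fun i => by
    have hi0 : (p i : ℂ) ≠ 0 := by exact_mod_cast (hp0 i).ne'
    have hi1 : (p (i + 1) : ℂ) ≠ 0 := by exact_mod_cast (hp0 (i + 1)).ne'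
    have hconj : Star.star T * (Star.star (T ^ i) * T ^ i) * T
        = Star.star (T ^ (i + 1)) * T ^ (i + 1) := by
      rw [pow_succ T, star_mul]
      simp only [mul_assoc]
    rw [Complex.ofReal_sub, sub_smul, Complex.ofReal_pow c, hu i, mul_smul_comm, smul_mul_assoc,
      hconj, hu (i + 1), smul_smul (Complex.ofReal _)]
    congr 2
    push_cast
    field_simp
  have h1 : Tendsto (cesaro ℂ (fun i => Star.star T * u i * T - ((c : ℂ) ^ 2) • u (i + 1)))
      atTop (𝓝 0) := by
    refine tendsto_cesaro_zero_of_le (fun i hi => ?_) hpc.tendsto_cesaro_sq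
    rw [hstep, norm_smul, Complex.norm_real, Real.norm_eq_abs]
    exact mul_le_of_le_one_right (abs_nonneg _) (hu1 (i + 1) (by omega))
  have h2 := (tendsto_cesaro_succ_sub (𝕜 := ℂ) hu1).const_smul ((c : ℂ) ^ 2)
  have h3 := h1.add h2
  rw [smul_zero, add_zero] at h3
  refine h3.congr fun n => ?_
  have e1 : cesaro ℂ (fun i => Star.star T * u i * T) n = Star.star T * cesaro ℂ u n * T := by
    simp only [cesaro, mul_smul_comm, smul_mul_assoc, Finset.mul_sum, Finset.sum_mul]
  have e2 : cesaro ℂ (fun i => ((c : ℂ) ^ 2) • u (i + 1)) n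
      = ((c : ℂ) ^ 2) • cesaro ℂ (fun i => u (i + 1)) n := by
    simp only [cesaro, ← Finset.smul_sum, smul_comm ((c : ℂ) ^ 2)]
  rw [cesaro_sub, e1, e2, smul_sub, hav]
  abel

/-- The weak limit points of the averages `powerAverage p T` are positive contractions that `T`
scales by `c²`. -/
theorem exists_invariant_of_isDominated {c : ℝ} (hp : IsGaugeWith p c) (h : IsDominated T p)
    (U : Ultrafilter ℕ) (hU : (U : Filter ℕ) ≤ atTop) :
    ∃ B, WeaklyTendsto (powerAverage p T) U B ∧ B.IsPositive ∧ (1 - B).IsPositive ∧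
      Star.star T * B * T = ((c : ℂ) ^ 2) • B := by
  obtain ⟨B, hB⟩ := exists_weaklyTendsto (powerAverage p T) (norm_powerAverage_le hp.1 h) U
  refine ⟨B, hB, hB.isPositive isPositive_powerAverage,
    hB.one_sub.isPositive (isPositive_one_sub_powerAverage hp.1 h), ?_⟩
  exact ((hB.const_mul _).mul_const _).unique
    ((hB.const_smul _).congr_norm ((tendsto_conj_powerAverage_sub hp h).mono_left hU))

/-- The lower bound on `q'` makes the invariant operator injective, in the sense that its quadratic
form vanishes only at `0`. -/
theorem inner_ne_zero_of_le_qInf {U : Ultrafilter ℕ} (hU : (U : Filter ℕ) ≤ atTop)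
    {B : H →L[ℂ] H} (hB : WeaklyTendsto (powerAverage p T) U B) (hp : ∀ n, 0 < p n)
    (h : IsDominated T p) {x : H} {ρ : ℝ} (hρ : 0 < ρ)
    (hx : ρ ≤ qInf fun i => ‖(T ^ i) x‖ ^ 2 / p i ^ 2) : inner ℂ x (B x) ≠ 0 := by
  have hev := eventually_le_cesaro_of_le_qInf (C := ‖x‖ ^ 2) (fun i => by positivity)
    (norm_sq_div_le hp h x) hρ hx
  have hre := (Complex.continuous_re.tendsto _).comp (hB x x)
  have hle := ge_of_tendsto hre ((hev.filter_mono hU).mono fun n hn => by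
    rw [Function.comp_apply, inner_powerAverage, Complex.ofReal_re]
    exact hn)
  intro h0
  rw [h0, Complex.zero_re] at hle
  linarith

end Asymptotic

/-! ### Trace arguments -/

section Trace

variable {M : VonNeumannAlgebra H}

theorem coe_powerAverage (p : ℕ → ℝ) (t : M.toStarSubalgebra) (n : ℕ) :
    ((powerAverage p t n : M.toStarSubalgebra) : H →L[ℂ] H) = powerAverage p (t : H →L[ℂ] H) n :=
  map_cesaro M.toStarSubalgebra.subtype.toAlgHom.toLinearMap
    (fun i => ((p i : ℂ) ^ 2)⁻¹ • (star (t ^ i) * t ^ i)) n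

theorem sqrt_mem {e : H →L[ℂ] H} (he : e ∈ M) : CFC.sqrt e ∈ M := by
  rw [← M.commutant_commutant, VonNeumannAlgebra.mem_commutant_iff]
  intro g hg
  rw [VonNeumannAlgebra.mem_commutant_iff] at hg
  have hc : Commute e g := hg e he
  exact (hc.cfcₙ_nnreal _).symm

/-- If `b` has a definite quadratic form and `e ≥ 0`, then `τ(be) = 0` forces `e = 0`. -/
theorem IsFaithfulNormalTrace.eq_zero_of_trace_mul_eq_zero {τ : M.toStarSubalgebra →ₗ[ℂ] ℂ}
    (hτ : IsFaithfulNormalTrace M τ) {b e : M.toStarSubalgebra}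
    (hb : (b : H →L[ℂ] H).IsPositive) (hb0 : ∀ x, x ≠ 0 → inner ℂ x ((b : H →L[ℂ] H) x) ≠ 0)
    (he : (e : H →L[ℂ] H).IsPositive) (h : τ (b * e) = 0) : e = 0 := by
  have he' : 0 ≤ (e : H →L[ℂ] H) := (ContinuousLinearMap.nonneg_iff_isPositive _).2 he
  let s : M.toStarSubalgebra := ⟨CFC.sqrt (e : H →L[ℂ] H), sqrt_mem e.2⟩
  have hs : s * s = e := Subtype.ext (CFC.sqrt_mul_sqrt_self (e : H →L[ℂ] H) he')
  have hsa : ContinuousLinearMap.adjoint (s : H →L[ℂ] H) = s :=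
    (IsSelfAdjoint.of_nonneg (CFC.sqrt_nonneg (e : H →L[ℂ] H))).star_eq
  have hpos : ((s * b * s : M.toStarSubalgebra) : H →L[ℂ] H).IsPositive := by
    have := hb.adjoint_conj (s : H →L[ℂ] H)
    rwa [hsa] at this
  have hzero : s * b * s = 0 := hτ.faithful _ hpos (by
    rw [mul_assoc, hτ.tracial, mul_assoc, hs, h])
  have hs0 : s = 0 := by
    refine Subtype.ext (ContinuousLinearMap.ext fun x => ?_)
    by_contra hx
    refine hb0 _ hx ?_
    rw [← ContinuousLinearMap.adjoint_inner_right, hsa]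
    have := congrArg (fun a : M.toStarSubalgebra => (a : H →L[ℂ] H) x) hzero
    exact (congrArg (inner ℂ x) this).trans (inner_zero_right x)
  rw [← hs, hs0, mul_zero]

/-- In a finite von Neumann algebra, an operator `t` that is dominated by a regular gauge with
constant `c`, and whose orbits stay away from zero on average, satisfies `t⋆t = c² = tt⋆`. -/
theorem IsFaithfulNormalTrace.star_mul_self_eq {τ : M.toStarSubalgebra →ₗ[ℂ] ℂ}
    (hτ : IsFaithfulNormalTrace M τ) {p : ℕ → ℝ} {c : ℝ} (hp : IsGaugeWith p c)
    (hreg : StronglyAlmostConvergesTo (fun n => c ^ n / p n) 1) {t : M.toStarSubalgebra}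
    (ht : IsDominated (t : H →L[ℂ] H) p)
    (hlow : ∀ x : H, x ≠ 0 → ∃ ρ : ℝ, 0 < ρ ∧
      ρ ≤ qInf fun i => ‖((t : H →L[ℂ] H) ^ i) x‖ ^ 2 / p i ^ 2) :
    star t * t = ((c : ℂ) ^ 2) • (1 : M.toStarSubalgebra) ∧
      t * star t = ((c : ℂ) ^ 2) • (1 : M.toStarSubalgebra) := by
  have hU : (hyperfilter ℕ : Filter ℕ) ≤ atTop := Nat.hyperfilter_le_atTop
  obtain ⟨B, hB, hB0, hB1, hBT⟩ := exists_invariant_of_isDominated hp ht (hyperfilter ℕ) hU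
  obtain ⟨D, hD, hD0, hD1, hDT⟩ := exists_invariant_of_isDominated hp ht.star (hyperfilter ℕ) hU
  have hcoe : ∀ n, ((powerAverage p (star t) n : M.toStarSubalgebra) : H →L[ℂ] H)
      = powerAverage p (star (t : H →L[ℂ] H)) n := coe_powerAverage p (star t)
  let b : M.toStarSubalgebra := ⟨B, hB.mem_vonNeumannAlgebra fun n => by
    rw [← coe_powerAverage]; exact (powerAverage p t n).2⟩
  let d : M.toStarSubalgebra := ⟨D, hD.mem_vonNeumannAlgebra fun n => by
    rw [← hcoe]; exact (powerAverage p (star t) n).2⟩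
  have hbt : star t * b * t = ((c : ℂ) ^ 2) • b := Subtype.ext hBT
  have hdt : t * d * star t = ((c : ℂ) ^ 2) • d := by
    refine Subtype.ext ?_
    rw [star_star] at hDT
    exact hDT
  have hnorm : ∀ n, ‖((powerAverage p t n : M.toStarSubalgebra) : H →L[ℂ] H)‖ ≤ 1 := fun n => by
    rw [coe_powerAverage]; exact norm_powerAverage_le hp.1 ht n
  have hnorm' : ∀ n, ‖((powerAverage p (star t) n : M.toStarSubalgebra) : H →L[ℂ] H)‖ ≤ 1 :=
    fun n => by rw [hcoe]; exact norm_powerAverage_le hp.1 ht.star n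
  -- `τ(b tⁿ t⋆ⁿ) = τ(t⋆ⁿ b tⁿ) = c²ⁿ τ(b)`, and the averages of `c²ⁿ / p(n)²` tend to `1`
  have htr : τ (b * d) = τ b := by
    have h1 : Tendsto (fun n => τ (b * powerAverage p (star t) n)) (hyperfilter ℕ) (𝓝 (τ (b * d))) :=
      hτ.tendsto (X := fun n => b * powerAverage p (star t) n) (C := ‖B‖ * 1)
        (fun n => (norm_mul_le _ _).trans (by gcongr; exact hnorm' n))
        (by
          change WeaklyTendsto (fun n => B *
            ((powerAverage p (star t) n : M.toStarSubalgebra) : H →L[ℂ] H)) _ (B * D)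
          simpa only [hcoe] using hD.const_mul B)
    have hterm : ∀ n, τ (b * powerAverage p (star t) n)
        = cesaro ℂ (fun i => ((((c ^ i / p i) ^ 2 : ℝ)) : ℂ) * τ b) n := fun n => by
      refine (map_cesaro (τ ∘ₗ LinearMap.mulLeft ℂ b) _ n).trans ?_
      congr 1
      funext i
      have e : τ (b * (t ^ i * star (t ^ i))) = ((c : ℂ) ^ 2) ^ i * τ b := by
        rw [← mul_assoc, hτ.tracial, ← mul_assoc, star_pow_mul_mul_pow hbt, map_smul, smul_eq_mul]
      simp only [LinearMap.comp_apply, LinearMap.mulLeft_apply, map_smul,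
        star_pow, star_star, smul_eq_mul] at e ⊢
      rw [e]
      push_cast
      ring
    have h2 : Tendsto (fun n => τ (b * powerAverage p (star t) n)) atTop (𝓝 (τ b)) := by
      rw [← tendsto_sub_nhds_zero_iff]
      have := (hreg.tendsto_cesaro_sq).const_mul ‖τ b‖
      rw [mul_zero] at this
      refine squeeze_zero_norm (fun n => ?_) this
      rw [hterm, ← cesaro_const (𝕜 := ℂ) (τ b) n, ← cesaro_sub]
      refine (norm_cesaro_le _ n).trans (le_of_eq ?_)
      rw [cesaro_const]
      refine Eq.trans ?_ (map_cesaro (LinearMap.mulLeft ℝ ‖τ b‖) _ n).symm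
      congr 1
      funext i
      rw [← sub_one_mul, norm_mul, mul_comm, ← Complex.ofReal_one, ← Complex.ofReal_sub,
        Complex.norm_real, Real.norm_eq_abs, LinearMap.mulLeft_apply, one_pow]
    exact tendsto_nhds_unique h1 (h2.mono_left hU)
  have hd : d = 1 := by
    refine (sub_eq_zero.1 (hτ.eq_zero_of_trace_mul_eq_zero (b := b) (e := 1 - d) hB0 (fun x hx => ?_)
      hD1 ?_)).symm
    · obtain ⟨ρ, hρ, hle⟩ := hlow x hx
      exact inner_ne_zero_of_le_qInf hU hB hp.1 ht hρ hle
    · rw [mul_sub, mul_one, map_sub, htr, sub_self]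
  have hbd : τ b = τ d := by
    have h1 : Tendsto (fun n => τ (powerAverage p t n)) (hyperfilter ℕ) (𝓝 (τ b)) :=
      hτ.tendsto hnorm (by simpa only [coe_powerAverage] using hB)
    have h2 : Tendsto (fun n => τ (powerAverage p (star t) n)) (hyperfilter ℕ) (𝓝 (τ d)) :=
      hτ.tendsto hnorm' (by simpa only [hcoe] using hD)
    refine tendsto_nhds_unique h1 (h2.congr fun n => ?_)
    refine (map_cesaro τ _ n).trans (Eq.trans ?_ (map_cesaro τ _ n).symm)
    congr 1
    funext i
    rw [map_smul, map_smul, hτ.tracial]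
    simp only [star_pow, star_star]
  have hb : b = 1 :=
    (sub_eq_zero.1 (hτ.faithful (1 - b) hB1 (by rw [map_sub, hbd, hd, sub_self]))).symm
  rw [hb, mul_one] at hbt
  rw [hd, mul_one] at hdt
  exact ⟨hbt, hdt⟩

end Trace

/-! ### Spectral radius and conclusion -/

/-- A nonzero multiple of a unitary operator has its scaling factor as spectral radius. -/
theorem spectralRadius_toReal_eq [Nontrivial H] {T : H →L[ℂ] H} {c : ℝ} (hc : 0 < c)
    (h : star T * T = ((c : ℂ) ^ 2) • (1 : H →L[ℂ] H))
    (h' : T * star T = ((c : ℂ) ^ 2) • (1 : H →L[ℂ] H)) :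
    (spectralRadius ℂ T).toReal = c := by
  have : IsStarNormal T := ⟨h.trans h'.symm⟩
  rw [IsStarNormal.spectralRadius_eq_nnnorm, ENNReal.coe_toReal, coe_nnnorm]
  have hn := CStarRing.norm_star_mul_self (x := T)
  rw [h, norm_smul, norm_one, mul_one, norm_pow, Complex.norm_real, Real.norm_of_nonneg hc.le,
    sq] at hn
  exact (mul_self_inj hc.le (norm_nonneg _)).1 hn |>.symm

end FiniteVN

end

theorem theorem3p2 {H : Type*} [NormedAddCommGroup H] [InnerProductSpace ℂ H] [CompleteSpace H]
    [TopologicalSpace.SeparableSpace H]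
    (M : VonNeumannAlgebra H) (hM : FiniteVN.IsFinite M)
    (S : Set (H →L[ℂ] H)) (hSM : ∀ T ∈ S, T ∈ M)
    (hSab : ∀ T ∈ S, ∀ T' ∈ S, T * T' = T' * T)
    (p : ℕ → ℝ) (hp : FiniteVN.IsRegularGauge p)
    (hS : FiniteVN.IsAsymptoticallyControlled S p) :
    ∃ A : (H →L[ℂ] H)ˣ, (A : H →L[ℂ] H) ∈ M ∧ ((A⁻¹ : (H →L[ℂ] H)ˣ) : H →L[ℂ] H) ∈ M ∧
      ∀ T ∈ S, 0 < (spectralRadius ℂ T).toReal ∧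
        (((spectralRadius ℂ T).toReal : ℂ)⁻¹ •
            ((A : H →L[ℂ] H) * T * ((A⁻¹ : (H →L[ℂ] H)ˣ) : H →L[ℂ] H)))
          ∈ unitary (H →L[ℂ] H) := by
  obtain ⟨τ, hτ⟩ := hM
  obtain ⟨c, hpc, hreg⟩ := hp
  have hc : 0 < c := hpc.2.1
  have hc' : (c : ℂ) ≠ 0 := by exact_mod_cast hc.ne'
  -- each `c⁻¹ T` is itself unitary, so conjugation by the identity suffices
  refine ⟨1, one_mem M, by simp [one_mem M], fun T hT => ?_⟩
  have := (hS.1 T hT).nontrivial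
  obtain ⟨h1, h2⟩ := hτ.star_mul_self_eq hpc hreg (t := ⟨T, hSM T hT⟩) (hS.1 T hT).1
    (fun x hx => hS.exists_le_qInf hT hx)
  replace h1 : star T * T = ((c : ℂ) ^ 2) • (1 : H →L[ℂ] H) := congrArg Subtype.val h1
  replace h2 : T * star T = ((c : ℂ) ^ 2) • (1 : H →L[ℂ] H) := congrArg Subtype.val h2
  rw [FiniteVN.spectralRadius_toReal_eq hc h1 h2]
  refine ⟨hc, ?_⟩
  have hscal : (c : ℂ)⁻¹ * ((c : ℂ)⁻¹ * (c : ℂ) ^ 2) = 1 := by field_simp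
  rw [inv_one, Units.val_one, one_mul, mul_one, Unitary.mem_iff]
  constructor <;>
    simp [star_smul, smul_smul, h1, h2, hscal]
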